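/- Let $\mathcal N$ be a von Neumann algebra on a complex Hilbert space, let $\mathfrak Z$ be a unital von Neumann subalgebra of the centre of $\mathcal N$, and identify $\mathfrak Z$ with $L^\infty(X,\nu)$ by a $*$-isomorphism, for some measure space $(X,\nu)$. Let $\hat{\mathfrak Z}_+\supseteq\mathfrak Z_+$ be the set of measurable functions $X\to[0,\infty]$ modulo equality $\nu$-almost everywhere, with pointwise operations ($0\cdot\infty=0$) and the almost everywhere order. A $\mathfrak Z$-trace on $\mathcal N_+$ is a map $\phi:\mathcal N_+\to\hat{\mathfrak Z}_+$ with $\phi(S+T)=\phi(S)+\phi(T)$, $\phi(zS)=z\,\phi(S)$ and $\phi(USU^*)=\phi(S)$ for all $S,T\in\mathcal N_+$, $z\in\mathfrak Z_+$ and unitaries $U\in\mathcal N$. It is faithful if $\phi(S)=0$ implies $S=0$ for $S\in\mathcal N_+$; semifinite if for every nonzero $S\in\mathcal N_+$ there is a nonzero $T\in\mathcal N_+$ with $T\le S$ and $\phi(T)\in\mathfrak Z_+$; normal if for every bounded increasing net $(S_\alpha)$ in $\mathcal N_+$ with supremum $S$, $\phi(S)$ is the supremum of $(\phi(S_\alpha))$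 in $\hat{\mathfrak Z}_+$. Let $\phi$ be a faithful, normal, semifinite $\mathfrak Z$-trace on $\mathcal N_+$. A projection $E\in\mathcal N$ is $\phi$-finite if $\phi(E)\in\mathfrak Z_+$; $\mathcal K^\phi_{\mathcal N}$ denotes the norm-closed two-sided ideal of $\mathcal N$ generated by the $\phi$-finite projections. For $T\in\mathcal N$ let $N_T$ be the projection on $\ker T$. The operator $T$ is $\phi$-Fredholm if $N_T$ is $\phi$-finite and there is a $\phi$-finite projection $E\in\mathcal N$ with $\operatorname{range}(1-E)\subseteq\operatorname{range}(T)$; in that case $N_{T^*}$ is also $\phi$-finite (by (3) below), and $\phi\text{-Index}(T):=\phi(N_T)-\phi(N_{T^*})\in\mathfrak Z$. Then: (1) (Fredholm alternative) If $T\in\mathcal K^\phi_{\mathcal N}$, then $1-T$ is $\phi$-Fredholm and $\phi\text{-Index}(1-T)=0$. (2) (Atkinson's theorem) $T\in\mathcal N$ is $\phi$-Fredholm if and only if $T+\mathcal K^\phi_{\mathcal N}$ is invertible in $\mathcal N/\mathcal K^\phi_{\mathcal N}$. (3) If $S,T\in\mathcal N$ are $\phi$-Fredholm, then so are $S^*$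 and $ST$, and $\phi\text{-Index}(S^*)=-\phi\text{-Index}(S)$, $\phi\text{-Index}(ST)=\phi\text{-Index}(S)+\phi\text{-Index}(T)$. -/

import Mathlib

open MeasureTheory
open scoped ENNReal

namespace ZTrace

noncomputable section

universe u v

variable {H : Type u} [NormedAddCommGroup H] [InnerProductSpace ℂ H] [CompleteSpace H]

instance instSMulMemClass : SMulMemClass (VonNeumannAlgebra H) ℂ (H →L[ℂ] H) where
  smul_mem {s} c _ hx := s.toStarSubalgebra.smul_mem hx c

/-- The projection on the kernel of an element of a von Neumann algebra lies in the algebra. -/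
theorem ker_starProjection_mem (N : VonNeumannAlgebra H) (T : N) :
    (T : H →L[ℂ] H).ker.starProjection ∈ N := by
  refine (VonNeumannAlgebra.IsStarProjection.mem_iff (isStarProjection_starProjection) N).2 ?_
  intro y hy
  rw [Submodule.range_starProjection]
  intro x hx
  have h := VonNeumannAlgebra.mem_commutant_iff.1 hy (T : H →L[ℂ] H) T.2
  have h2 : (T : H →L[ℂ] H) (y x) = y ((T : H →L[ℂ] H) x) := congr($h x)
  have hx' : (T : H →L[ℂ] H) x = 0 := hx
  change (T : H →L[ℂ] H) (y x) = 0
  rw [h2, hx', map_zero]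

/-- `N_T`, the orthogonal projection on `ker T`, as an element of the algebra. -/
def kerProj {N : VonNeumannAlgebra H} (T : N) : N :=
  ⟨(T : H →L[ℂ] H).ker.starProjection, ker_starProjection_mem N T⟩

variable {X : Type v} [MeasurableSpace X]

/-- A `*`-isomorphism of the von Neumann algebra `Z` onto the algebra `L^∞(X, ν)` of (classes of)
essentially bounded measurable complex functions with pointwise operations. -/
structure LInftyIso (Z : VonNeumannAlgebra H) (ν : Measure X) where
  toLinearEquiv : Z ≃ₗ[ℂ] Lp ℂ ∞ ν
  map_mul : ∀ a b : Z, ⇑(toLinearEquiv (a * b)) =ᵐ[ν]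
    fun x => toLinearEquiv a x * toLinearEquiv b x
  map_star : ∀ a : Z, toLinearEquiv (star a) = star (toLinearEquiv a)

/-- The `[0, ∞]`-valued measurable functions on `X`, modulo equality almost everywhere, with the
almost everywhere order: the extended positive cone of `L^∞(X, ν)`. -/
abbrev ExtPos (ν : Measure X) : Type v := X →ₘ[ν] ℝ≥0∞

/-- Pointwise product in the extended positive cone, with `0 * ∞ = 0`. -/
def ExtPos.mul {ν : Measure X} (f g : ExtPos ν) : ExtPos ν :=
  AEEqFun.comp₂Measurable (fun a b : ℝ≥0∞ => a * b) (measurable_fst.mul measurable_snd) f g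

variable {N Z : VonNeumannAlgebra H} {ν : Measure X}

/-- The function in the extended positive cone that corresponds to a positive `z : Z`
(the isomorphism with `L^∞(X, ν)` sends such `z` to nonnegative real functions). Only used for
`0 ≤ z`. -/
def LInftyIso.toExt (e : LInftyIso Z ν) (z : Z) : ExtPos ν :=
  AEEqFun.comp (fun w : ℂ => ENNReal.ofReal w.re)
    (ENNReal.continuous_ofReal.comp Complex.continuous_re) (e.toLinearEquiv z : X →ₘ[ν] ℂ)

/-- `φ` is a `Z`-trace on the positive cone of `N`. Only the values of `φ` on
positive elements are constrained, and only those values are ever used. -/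
structure IsZTrace (hZN : Z ≤ N) (e : LInftyIso Z ν) (φ : N → ExtPos ν) : Prop where
  map_add : ∀ S T : N, 0 ≤ S → 0 ≤ T → φ (S + T) = φ S + φ T
  map_mul : ∀ (S : N) (z : Z), 0 ≤ S → 0 ≤ z →
    φ (⟨z, hZN z.2⟩ * S) = ExtPos.mul (e.toExt z) (φ S)
  map_unitary : ∀ S U : N, 0 ≤ S → U ∈ unitary N → φ (U * S * star U) = φ S

/-- `φ` vanishes on no nonzero positive element. -/
def IsFaithful (φ : N → ExtPos ν) : Prop :=
  ∀ S : N, 0 ≤ S → φ S = 0 → S = 0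

/-- `φ(S)` lies in `Z₊`, that is, it is the function given by a positive element of `Z`. -/
def FiniteAt (e : LInftyIso Z ν) (φ : N → ExtPos ν) (S : N) : Prop :=
  ∃ z : Z, 0 ≤ z ∧ e.toExt z = φ S

/-- Every nonzero positive element dominates a nonzero positive element with trace in `Z₊`. -/
def IsSemifinite (e : LInftyIso Z ν) (φ : N → ExtPos ν) : Prop :=
  ∀ S : N, 0 ≤ S → S ≠ 0 → ∃ T : N, 0 ≤ T ∧ T ≠ 0 ∧ T ≤ S ∧ FiniteAt e φ T

/-- `φ` preserves suprema of bounded increasing nets of positive elements (a net enters through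
its set of values, an upward directed set). -/
def IsNormal (φ : N → ExtPos ν) : Prop :=
  ∀ (D : Set N) (S : N), D.Nonempty → DirectedOn (· ≤ ·) D → (∀ R ∈ D, 0 ≤ R) →
    IsLUB D S → IsLUB (φ '' D) (φ S)

/-- A projection `E` in `N` with `φ(E)` in `Z₊`. -/
def IsFiniteProj (e : LInftyIso Z ν) (φ : N → ExtPos ν) (E : N) : Prop :=
  IsStarProjection E ∧ FiniteAt e φ E

/-- `K^φ_N`: the smallest norm-closed two-sided ideal of `N` that contains all `φ`-finite
projections. -/
def compactIdeal (e : LInftyIso Z ν) (φ : N → ExtPos ν) : TwoSidedIdeal N :=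
  sInf {I : TwoSidedIdeal N | IsClosed (I : Set N) ∧ ∀ E : N, IsFiniteProj e φ E → E ∈ I}

/-- `T` is `φ`-Fredholm: `N_T` is `φ`-finite and the range of `T` contains the range of `1 - E`
for some `φ`-finite projection `E`. -/
def IsFredholm (e : LInftyIso Z ν) (φ : N → ExtPos ν) (T : N) : Prop :=
  IsFiniteProj e φ (kerProj T) ∧
    ∃ E : N, IsFiniteProj e φ E ∧
      Set.range ((1 - E : N) : H →L[ℂ] H) ⊆ Set.range (T : H →L[ℂ] H)

open Classical in
/-- The element of `Z₊` (unique, by injectivity of the isomorphism) that represents `φ(S)`, when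
there is one. -/
def value (e : LInftyIso Z ν) (φ : N → ExtPos ν) (S : N) : Z :=
  if h : FiniteAt e φ S then h.choose else 0

/-- The `Z`-valued index `φ(N_T) - φ(N_{T*})`. -/
def index (e : LInftyIso Z ν) (φ : N → ExtPos ν) (T : N) : Z :=
  value e φ (kerProj T) - value e φ (kerProj (star T))

end

end ZTrace

namespace ZTrace

noncomputable section

variable {H : Type*} [NormedAddCommGroup H] [InnerProductSpace ℂ H] [CompleteSpace H]
variable {N : VonNeumannAlgebra H}

/-! ### Kernel projections and range projections -/

/-! Call an element finite rank if a `φ`-finite projection absorbs it on the left. The heart of the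
matter is that the left and right supports of any operator are Murray–von Neumann equivalent, so
they have the same trace as soon as one is finite (`finiteAt_rangeProj_star`). Unitary invariance of
`φ` reaches partial isometries because unitaries span `N`.

If `A * S = 1 - E` with `E` finite, then `(1 - E) * A` has cokernel projection exactly `E`. Its
kernel exceeds `ker A` by a projection equivalent to `E - kerProj (star A)`, so the index is
unchanged (`kerProj_one_sub_mul`). Operators that differ by finite rank become equal after such a
cut with large `E`; hence Fredholmness and index survive finite-rank perturbation (`isFredholm_add`,
`index_add`).

A compact operator is finite rank plus an element of norm below one, so `1 - T` is an invertible
perturbed by finite rank: this is the Fredholm alternative. Atkinson's theorem follows by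
parametrices. For products, finite-rank changes make the factors fit, and the kernel of the product
splits. -/

theorem isStarProjection_kerProj (T : N) : IsStarProjection (kerProj T) := by
  have h : IsStarProjection ((kerProj T : N) : H →L[ℂ] H) := isStarProjection_starProjection
  exact ⟨Subtype.ext h.1, Subtype.ext h.2⟩

theorem star_kerProj (T : N) : star (kerProj T) = kerProj T :=
  (isStarProjection_kerProj T).isSelfAdjoint

theorem kerProj_mul_self (T : N) : kerProj T * kerProj T = kerProj T :=
  (isStarProjection_kerProj T).isIdempotentElem

theorem mul_kerProj (T : N) : T * kerProj T = 0 := by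
  refine Subtype.ext (ContinuousLinearMap.ext fun x => ?_)
  exact ((T : H →L[ℂ] H).ker.starProjection_apply_mem x : _)

theorem kerProj_mul_of_mul_eq_zero {T X : N} (h : T * X = 0) : kerProj T * X = X := by
  refine Subtype.ext (ContinuousLinearMap.ext fun x => ?_)
  refine Submodule.starProjection_eq_self_iff.2 ?_
  exact congr(($h : H →L[ℂ] H) x)

theorem kerProj_star_mul (T : N) : kerProj (star T) * T = 0 := by
  simpa [star_kerProj] using congr(star $(mul_kerProj (star T)))

/-- Each projection absorbs the other, so they agree. This describes kernels by right annihilators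
inside `N` and turns later arguments into algebra. -/
theorem eq_kerProj {T P : N} (hP : IsStarProjection P) (hTP : T * P = 0)
    (h : ∀ X, T * X = 0 → P * X = X) : kerProj T = P := by
  have h1 := kerProj_mul_of_mul_eq_zero hTP
  have h2 := congr(star $(h _ (mul_kerProj T)))
  rw [star_mul, star_kerProj, hP.isSelfAdjoint.star_eq] at h2
  rw [← h2, h1]

/-- The projection on the closure of the range of `T`. -/
def rangeProj (T : N) : N := 1 - kerProj (star T)

theorem isStarProjection_rangeProj (T : N) : IsStarProjection (rangeProj T) :=
  (isStarProjection_kerProj _).one_sub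

theorem rangeProj_mul (T : N) : rangeProj T * T = T := by
  rw [rangeProj, sub_mul, kerProj_star_mul, one_mul, sub_zero]

theorem mul_rangeProj_star (T : N) : T * rangeProj (star T) = T := by
  rw [rangeProj, star_star, mul_sub, mul_kerProj, mul_one, sub_zero]

theorem rangeProj_mul_of_star_mul_eq_zero {T X : N} (h : star T * X = 0) :
    rangeProj T * X = 0 := by
  rw [rangeProj, sub_mul, kerProj_mul_of_mul_eq_zero h, one_mul, sub_self]

theorem eq_rangeProj {T P : N} (hP : IsStarProjection P) (hPT : P * T = T)
    (h : ∀ X, star T * X = 0 → P * X = 0) : rangeProj T = P := by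
  have h2 : star T * P = star T := by
    simpa [hP.isSelfAdjoint.star_eq] using congr(star $hPT)
  rw [rangeProj, eq_kerProj hP.one_sub (by rw [mul_sub, h2, mul_one, sub_self])
    (fun X hX => by rw [sub_mul, h X hX, one_mul, sub_zero]), sub_sub_cancel]

theorem mul_rangeProj_of_mul_eq {T P : N} (hP : IsStarProjection P) (h : P * T = T) :
    P * rangeProj T = rangeProj T := by
  have h2 : star T * (1 - P) = 0 := by
    have := congr(star $h)
    rw [star_mul, hP.isSelfAdjoint.star_eq] at this
    rw [mul_sub, this, mul_one, sub_self]
  have h3 := congr(star $(rangeProj_mul_of_star_mul_eq_zero h2))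
  rw [star_mul, (isStarProjection_rangeProj T).isSelfAdjoint.star_eq,
    hP.one_sub.isSelfAdjoint.star_eq, star_zero, sub_mul, one_mul, sub_eq_zero] at h3
  exact h3.symm

/-! ### Square roots, polar decomposition and factorization in a von Neumann algebra -/

theorem mem_of_commute_commutant {S : H →L[ℂ] H} (h : ∀ y ∈ N.commutant, y * S = S * y) :
    S ∈ N := by
  rw [← VonNeumannAlgebra.commutant_commutant N]
  exact VonNeumannAlgebra.mem_commutant_iff.2 h

theorem commutant_mul_comm {y : H →L[ℂ] H} (hy : y ∈ N.commutant) (T : N) :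
    y * (T : H →L[ℂ] H) = T * y :=
  (VonNeumannAlgebra.mem_commutant_iff.1 hy T T.2).symm

/-- The operator square root commutes with everything commuting with `S`, so the bicommutant
property puts it in `N`. -/
theorem exists_sqrt {S : N} (hS : 0 ≤ S) : ∃ R : N, star R = R ∧ R * R = S := by
  have hS' : (0 : H →L[ℂ] H) ≤ S := hS
  have hmem : CFC.sqrt (S : H →L[ℂ] H) ∈ N := mem_of_commute_commutant fun y hy =>
    (Commute.cfcₙ_nnreal (commutant_mul_comm hy S).symm _).symm
  refine ⟨⟨_, hmem⟩, Subtype.ext ?_, Subtype.ext ?_⟩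
  · exact (CFC.sqrt_nonneg (S : H →L[ℂ] H)).isSelfAdjoint
  · exact CFC.sqrt_mul_sqrt_self _ hS'

theorem nonneg_star_mul_self (T : N) : 0 ≤ star T * T :=
  star_mul_self_nonneg (T : H →L[ℂ] H)

theorem nonneg_mul_star_self (T : N) : 0 ≤ T * star T :=
  mul_star_self_nonneg (T : H →L[ℂ] H)

theorem nonneg_of_isStarProjection {E : N} (hE : IsStarProjection E) : 0 ≤ E := by
  have := nonneg_star_mul_self E
  rwa [hE.isSelfAdjoint.star_eq, hE.isIdempotentElem] at this

/-- The operator `V` with `V B = A` that vanishes on the orthogonal complement of the range of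
`B`. -/
theorem exists_mul_eq_of_norm_le {A B : N} {c : ℝ}
    (h : ∀ x, ‖(A : H →L[ℂ] H) x‖ ≤ c * ‖(B : H →L[ℂ] H) x‖) :
    ∃ V : N, V * B = A ∧ V * kerProj (star B) = 0 := by
  set A' := (A : H →L[ℂ] H)
  set B' := (B : H →L[ℂ] H)
  let K : Submodule ℂ H := B'.range.topologicalClosure
  have hBK : ∀ x, B' x ∈ K := fun x => B'.range.le_topologicalClosure ⟨x, rfl⟩
  let b : H →ₗ[ℂ] K := B'.toLinearMap.codRestrict K hBK
  have hdense : DenseRange b := by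
    intro y
    rw [Metric.mem_closure_range_iff]
    intro ε hε
    obtain ⟨_, ⟨x, rfl⟩, hx⟩ := Metric.mem_closure_iff.1 y.2 ε hε
    exact ⟨x, hx⟩
  have : CompleteSpace K := B'.range.isClosed_topologicalClosure.completeSpace_coe
  let V : H →L[ℂ] H := (A'.toLinearMap.extendOfNorm b).comp K.orthogonalProjectionOnto
  have hVB : ∀ x, V (B' x) = A' x := fun x => by
    have h1 : K.orthogonalProjectionOnto (B' x) = b x :=
      K.orthogonalProjectionOnto_mem_subspace_eq_self ⟨B' x, hBK x⟩
    change A'.toLinearMap.extendOfNorm b (K.orthogonalProjectionOnto (B' x)) = A' x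
    rw [h1]
    exact LinearMap.extendOfNorm_eq (f := A'.toLinearMap) hdense ⟨c, h⟩ x
  have hV0 : ∀ x ∈ Kᗮ, V x = 0 := fun x hx => by
    change A'.toLinearMap.extendOfNorm b (K.orthogonalProjectionOnto x) = 0
    rw [Submodule.orthogonalProjectionOnto_eq_zero_iff.2 hx, map_zero]
  have hK : Kᗮ = (star B').ker := by
    rw [Submodule.orthogonal_closure]
    exact B'.orthogonal_range
  -- Commutation with `y` in the commutant holds on `K` by density. On `Kᗮ = ker B*`, which `y`
  -- preserves, both sides vanish.
  have hVmem : V ∈ N := by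
    refine mem_of_commute_commutant fun y hy => ?_
    have hyB : ∀ x, y (B' x) = B' (y x) := fun x => congr($(commutant_mul_comm hy B) x)
    have hyA : ∀ x, y (A' x) = A' (y x) := fun x => congr($(commutant_mul_comm hy A) x)
    have hyB' : ∀ x, y ((star B') x) = star B' (y x) := fun x =>
      congr($(commutant_mul_comm hy (star B)) x)
    have hon : ∀ x ∈ K, y (V x) = V (y x) := by
      intro x hx
      have hcl : IsClosed {x | y (V x) = V (y x)} :=
        isClosed_eq (by fun_prop) (by fun_prop)
      refine hcl.closure_subset_iff.2 ?_ hx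
      rintro _ ⟨w, rfl⟩
      change y (V (B' w)) = V (y (B' w))
      rw [hyB, hVB, hVB, hyA]
    refine ContinuousLinearMap.ext fun x => ?_
    change y (V x) = V (y x)
    have hx := K.starProjection_add_starProjection_orthogonal x
    have hperp : Kᗮ.starProjection x ∈ Kᗮ := Kᗮ.starProjection_apply_mem x
    have hyperp : y (Kᗮ.starProjection x) ∈ Kᗮ := by
      have hB : star B' (Kᗮ.starProjection x) = 0 := hK.le hperp
      refine hK.ge (show star B' _ = 0 from ?_)
      rw [← hyB', hB, map_zero]
    rw [← hx, map_add, map_add, map_add, map_add, hon _ (K.starProjection_apply_mem x),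
      hV0 _ hperp, hV0 _ hyperp, map_zero]
  refine ⟨⟨V, hVmem⟩, Subtype.ext (ContinuousLinearMap.ext hVB),
    Subtype.ext (ContinuousLinearMap.ext fun x => hV0 _ ?_)⟩
  rw [hK]
  exact (star B').ker.starProjection_apply_mem x

theorem norm_apply_eq_of_star_mul_self_eq {A B : N} (h : star A * A = star B * B) (x : H) :
    ‖(A : H →L[ℂ] H) x‖ = ‖(B : H →L[ℂ] H) x‖ := by
  have key : ∀ C : N,
      inner ℂ (((star C * C : N) : H →L[ℂ] H) x) x = (‖(C : H →L[ℂ] H) x‖ : ℂ) ^ 2 := by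
    intro C
    change inner ℂ ((ContinuousLinearMap.adjoint (C : H →L[ℂ] H)) ((C : H →L[ℂ] H) x)) x = _
    rw [ContinuousLinearMap.adjoint_inner_left, inner_self_eq_norm_sq_to_K]
    rfl
  have h2 := key A
  rw [h, key B] at h2
  have h3 : ‖(A : H →L[ℂ] H) x‖ ^ 2 = ‖(B : H →L[ℂ] H) x‖ ^ 2 := by exact_mod_cast h2.symm
  exact (sq_eq_sq₀ (norm_nonneg _) (norm_nonneg _)).1 h3

/-- Range and corange projections are Murray–von Neumann equivalent in the algebra. -/
theorem exists_partialIsometry (T : N) :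
    ∃ V : N, star V * V = rangeProj (star T) ∧ V * star V = rangeProj T := by
  obtain ⟨R, hR, hRR⟩ := exists_sqrt (nonneg_star_mul_self T)
  have hRR' : star T * T = star R * R := by rw [hR, hRR]
  obtain ⟨V, hVR, hV0⟩ := exists_mul_eq_of_norm_le (A := T) (B := R) (c := 1) fun x => by
    rw [norm_apply_eq_of_star_mul_self_eq hRR', one_mul]
  rw [hR] at hV0
  have hker : ∀ X : N, T * X = 0 ↔ R * X = 0 := fun X => by
    constructor
    · intro h
      refine Subtype.ext (ContinuousLinearMap.ext fun x => norm_eq_zero.1 ?_)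
      have := norm_apply_eq_of_star_mul_self_eq hRR' ((X : H →L[ℂ] H) x)
      refine this.symm.trans ?_
      rw [norm_eq_zero]
      exact congr(($h : H →L[ℂ] H) x)
    · intro h
      rw [← hVR, mul_assoc, h, mul_zero]
  have hk : kerProj T = kerProj R :=
    eq_kerProj (isStarProjection_kerProj R) ((hker _).2 (mul_kerProj R))
      fun X hX => kerProj_mul_of_mul_eq_zero ((hker X).1 hX)
  have hV0' : kerProj R * star V = 0 := by
    simpa [star_kerProj] using congr(star $hV0)
  have hkR : kerProj R * R = 0 := by simpa [hR] using kerProj_star_mul R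
  -- `(V*V - 1)R` maps into `ker R`, while `kerProj R` annihilates `V*` and `R` from the left.
  have h1 : (star V * V - 1) * R = 0 := by
    have h : R * ((star V * V - 1) * R) = 0 := by
      have : R * ((star V * V - 1) * R) = star (V * R) * (V * R) - R * R := by
        rw [star_mul, hR]; noncomm_ring
      rw [this, hVR, hRR, sub_self]
    rw [← kerProj_mul_of_mul_eq_zero h, ← mul_assoc, mul_sub, ← mul_assoc, hV0', mul_one, zero_mul,
      zero_sub, neg_mul, hkR, neg_zero]
  have h2 : R * (star V * V - 1) = 0 := by
    simpa [hR] using congr(star $h1)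
  have h3 := kerProj_mul_of_mul_eq_zero h2
  rw [mul_sub, ← mul_assoc, hV0', zero_mul, mul_one, zero_sub] at h3
  have h4 : star V * V = 1 - kerProj R := by rw [sub_eq_add_neg, h3]; abel
  have h5 : V * star V * V = V := by
    rw [mul_assoc, h4, mul_sub, hV0, mul_one, sub_zero]
  refine ⟨V, by rw [rangeProj, star_star, hk, h4], (eq_rangeProj ⟨?_, ?_⟩ ?_ ?_).symm⟩
  · change V * star V * (V * star V) = _
    rw [← mul_assoc, h5]
  · change star (V * star V) = _
    rw [star_mul, star_star]
  · rw [← hVR, ← mul_assoc, h5]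
  · intro X hX
    rw [← hVR, star_mul, hR, mul_assoc] at hX
    have := kerProj_mul_of_mul_eq_zero hX
    rw [← mul_assoc, hV0', zero_mul] at this
    rw [mul_assoc, ← this, mul_zero]

/-- If the range of `A` is contained in the range of `T`, then `A` factors through `T`. -/
theorem exists_mul_eq_of_range_subset {T A : N}
    (h : Set.range (A : H →L[ℂ] H) ⊆ Set.range (T : H →L[ℂ] H)) : ∃ S : N, T * S = A := by
  set T' := (T : H →L[ℂ] H)
  set A' := (A : H →L[ℂ] H)
  -- Preimages under `T` are unique in the orthogonal complement of its kernel. Uniqueness yields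
  -- linearity, continuity (closed graph) and commutation with the commutant.
  have hex : ∀ x, ∃ w ∈ T'.kerᗮ, T' w = A' x := fun x => by
    obtain ⟨w, hw⟩ := h ⟨x, rfl⟩
    refine ⟨T'.kerᗮ.starProjection w, Submodule.starProjection_apply_mem _ _, ?_⟩
    have h1 := T'.ker.starProjection_add_starProjection_orthogonal w
    have h2 : T' (T'.ker.starProjection w) = 0 := T'.ker.starProjection_apply_mem w
    rw [← hw, ← congr(T' $h1), map_add, h2, zero_add]
  have huniq : ∀ v ∈ T'.kerᗮ, ∀ w ∈ T'.kerᗮ, T' v = T' w → v = w := fun v hv w hw hvw => by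
    have h1 : v - w ∈ T'.ker := by
      change T' (v - w) = 0
      rw [map_sub, hvw, sub_self]
    have h2 : v - w ∈ T'.kerᗮ := sub_mem hv hw
    exact sub_eq_zero.1 (inner_self_eq_zero.1 (h2 _ h1))
  choose s hs hTs using hex
  let S : H →ₗ[ℂ] H :=
    { toFun := s
      map_add' := fun x y => huniq _ (hs _) _ (add_mem (hs _) (hs _)) (by simp [hTs])
      map_smul' := fun c x => huniq _ (hs _) _ (Submodule.smul_mem _ _ (hs _)) (by simp [hTs]) }
  have hcont : Continuous S := by
    refine S.continuous_of_seq_closed_graph fun u x y hu hSu => ?_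
    refine huniq _ (T'.ker.isClosed_orthogonal.mem_of_tendsto hSu
      (Filter.Eventually.of_forall fun n => hs _)) _ (hs _) ?_
    have h1 : Filter.Tendsto (fun n => T' (s (u n))) Filter.atTop (nhds (T' y)) :=
      (T'.continuous.tendsto y).comp hSu
    simp only [hTs] at h1
    refine tendsto_nhds_unique h1 ?_
    change Filter.Tendsto _ _ (nhds (T' (s x)))
    rw [hTs]
    exact (A'.continuous.tendsto x).comp hu
  let S' : H →L[ℂ] H := ⟨S, hcont⟩
  have hmem : S' ∈ N := by
    refine mem_of_commute_commutant fun y hy => ContinuousLinearMap.ext fun x => ?_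
    have hyT : ∀ x, y (T' x) = T' (y x) := fun x => congr($(commutant_mul_comm hy T) x)
    have hyA : ∀ x, y (A' x) = A' (y x) := fun x => congr($(commutant_mul_comm hy A) x)
    change y (s x) = s (y x)
    refine huniq _ ?_ _ (hs _) (by rw [hTs, ← hyT, hTs, hyA])
    intro w hw
    have hstar := commutant_mul_comm (star_mem hy) T
    have hw' : star y w ∈ T'.ker := by
      change T' (star y w) = 0
      have h1 : star y (T' w) = T' (star y w) := congr($hstar w)
      rw [← h1, show T' w = 0 from hw, map_zero]
    have h2 := hs x _ hw'
    rwa [ContinuousLinearMap.star_eq_adjoint, ContinuousLinearMap.adjoint_inner_left] at h2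
  exact ⟨⟨S', hmem⟩, Subtype.ext (ContinuousLinearMap.ext hTs)⟩

/-! ### Norm closedness and its C*-algebraic consequences -/

theorem isClosed_coe (N : VonNeumannAlgebra H) : IsClosed (N : Set (H →L[ℂ] H)) := by
  rw [← N.centralizer_centralizer]
  exact Set.isClosed_centralizer _

theorem span_unitary_eq_top (N : VonNeumannAlgebra H) :
    Submodule.span ℂ (unitary N : Set N) = ⊤ := by
  have := isClosed_coe N
  exact CStarAlgebra.span_unitary N

theorem isUnit_one_sub_of_norm_lt_one {T : N} (h : ‖T‖ < 1) : IsUnit (1 - T) := by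
  have : CompleteSpace N := (isClosed_coe N).completeSpace_coe
  exact (Units.oneSub T h).isUnit

variable {X : Type*} [MeasurableSpace X] {Z : VonNeumannAlgebra H} {ν : Measure X}

/-! ### The positive cone of `Z` inside the extended positive cone -/

theorem LInftyIso.coeFn_toExt (e : LInftyIso Z ν) (z : Z) :
    e.toExt z =ᵐ[ν] fun x => ENNReal.ofReal (e.toLinearEquiv z x).re :=
  AEEqFun.coeFn_comp _ _ _

theorem LInftyIso.coeFn_star (e : LInftyIso Z ν) (z : Z) :
    e.toLinearEquiv (star z) =ᵐ[ν] fun x => star (e.toLinearEquiv z x) := by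
  rw [e.map_star]
  exact AEEqFun.coeFn_star _

/-- The isomorphism respects only algebra and star, so positivity is carried by a self-adjoint
square root, whose image is real almost everywhere. -/
theorem LInftyIso.ae_nonneg (e : LInftyIso Z ν) {z : Z} (hz : 0 ≤ z) :
    ∀ᵐ x ∂ν, 0 ≤ (e.toLinearEquiv z x).re ∧ (e.toLinearEquiv z x).im = 0 := by
  obtain ⟨R, hR, rfl⟩ := exists_sqrt hz
  have h1 := e.coeFn_star R
  rw [hR] at h1
  filter_upwards [h1, e.map_mul R R] with x hx hx2
  have him : (e.toLinearEquiv R x).im = 0 := by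
    have := congr(Complex.im $hx)
    simp only [RCLike.star_def, Complex.conj_im] at this
    linarith
  rw [hx2]
  simp only [Complex.mul_re, Complex.mul_im, him, mul_zero, zero_mul, sub_zero, add_zero, and_true]
  exact mul_self_nonneg _

theorem LInftyIso.toExt_add (e : LInftyIso Z ν) {z w : Z} (hz : 0 ≤ z) (hw : 0 ≤ w) :
    e.toExt (z + w) = e.toExt z + e.toExt w := by
  refine AEEqFun.ext ?_
  have h1 : e.toLinearEquiv (z + w) =ᵐ[ν] e.toLinearEquiv z + e.toLinearEquiv w := by
    rw [map_add]
    exact Lp.coeFn_add _ _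
  filter_upwards [e.coeFn_toExt (z + w), e.coeFn_toExt z, e.coeFn_toExt w,
    AEEqFun.coeFn_add (e.toExt z) (e.toExt w), h1, e.ae_nonneg hz, e.ae_nonneg hw]
    with x h1 h2 h3 h4 h5 h6 h7
  rw [h1, h4, Pi.add_apply, h2, h3, h5, Pi.add_apply, Complex.add_re,
    ENNReal.ofReal_add h6.1 h7.1]

theorem LInftyIso.toExt_injOn (e : LInftyIso Z ν) {z w : Z} (hz : 0 ≤ z) (hw : 0 ≤ w)
    (h : e.toExt z = e.toExt w) : z = w := by
  refine e.toLinearEquiv.injective (Lp.ext ?_)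
  have h1 := e.coeFn_toExt z
  rw [h] at h1
  filter_upwards [h1, e.coeFn_toExt w, e.ae_nonneg hz, e.ae_nonneg hw] with x h1 h2 h3 h4
  refine Complex.ext ?_ (h3.2.trans h4.2.symm)
  exact (ENNReal.ofReal_eq_ofReal_iff h3.1 h4.1).1 (h1.symm.trans h2)

theorem LInftyIso.exists_toExt_eq_of_le (e : LInftyIso Z ν) {z : Z} {f : ExtPos ν}
    (h : f ≤ e.toExt z) : ∃ w : Z, 0 ≤ w ∧ e.toExt w = f := by
  have hbound : ∀ᵐ x ∂ν, f x ≤ ENNReal.ofReal ‖e.toLinearEquiv z‖ := by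
    filter_upwards [AEEqFun.coeFn_le.2 h, e.coeFn_toExt z,
      enorm_ae_le_eLpNormEssSup (e.toLinearEquiv z) ν] with x h1 h2 h3
    refine h1.trans (h2.trans_le ?_)
    refine (ENNReal.ofReal_le_ofReal (Complex.re_le_norm _)).trans ?_
    rw [ofReal_norm, ofReal_norm, Lp.enorm_def, eLpNorm_exponent_top]
    exact h3
  have hmeas : AEStronglyMeasurable (fun x => ((Real.sqrt (f x).toReal : ℝ) : ℂ)) ν := by
    have := f.aestronglyMeasurable.aemeasurable
    exact (Complex.measurable_ofReal.comp_aemeasurable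
      this.ennreal_toReal.sqrt).aestronglyMeasurable
  have hLp : MemLp (fun x => ((Real.sqrt (f x).toReal : ℝ) : ℂ)) ∞ ν := by
    refine memLp_top_of_bound hmeas (Real.sqrt ‖e.toLinearEquiv z‖) ?_
    filter_upwards [hbound] with x hx
    rw [Complex.norm_real, Real.norm_of_nonneg (Real.sqrt_nonneg _)]
    exact Real.sqrt_le_sqrt (ENNReal.toReal_le_of_le_ofReal (norm_nonneg _) hx)
  -- Realizing `√f` rather than `f` makes the witness `star r * r` positive in `Z` automatically.
  set r : Z := e.toLinearEquiv.symm hLp.toLp with hr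
  have her : e.toLinearEquiv r =ᵐ[ν] fun x => ((Real.sqrt (f x).toReal : ℝ) : ℂ) := by
    rw [hr, LinearEquiv.apply_symm_apply]
    exact hLp.coeFn_toLp
  refine ⟨star r * r, nonneg_star_mul_self r, AEEqFun.ext ?_⟩
  filter_upwards [e.coeFn_toExt (star r * r), e.map_mul (star r) r, e.coeFn_star r, her, hbound]
    with x h1 h2 h3 h4 h5
  rw [h1, h2, h3, h4, RCLike.star_def, Complex.conj_ofReal, ← Complex.ofReal_mul, Complex.ofReal_re,
    Real.mul_self_sqrt ENNReal.toReal_nonneg,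
    ENNReal.ofReal_toReal (h5.trans_lt ENNReal.ofReal_lt_top).ne]

/-! ### Elements of finite trace -/

variable {hZN : Z ≤ N} {e : LInftyIso Z ν} {φ : N → ExtPos ν}

theorem value_eq {S : N} {z : Z} (hz : 0 ≤ z) (h : e.toExt z = φ S) : value e φ S = z := by
  have hS : FiniteAt e φ S := ⟨z, hz, h⟩
  rw [value, dif_pos hS]
  exact e.toExt_injOn hS.choose_spec.1 hz (hS.choose_spec.2.trans h.symm)

theorem value_congr {S T : N} (hS : FiniteAt e φ S) (h : φ S = φ T) :
    value e φ S = value e φ T := by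
  obtain ⟨z, hz, hzS⟩ := hS
  rw [value_eq hz hzS, value_eq hz (hzS.trans h)]

theorem IsZTrace.finiteAt_add (hφ : IsZTrace hZN e φ) {S T : N} (hS : 0 ≤ S) (hT : 0 ≤ T)
    (hSf : FiniteAt e φ S) (hTf : FiniteAt e φ T) :
    FiniteAt e φ (S + T) ∧ value e φ (S + T) = value e φ S + value e φ T := by
  obtain ⟨z, hz, hzS⟩ := hSf
  obtain ⟨w, hw, hwT⟩ := hTf
  have h0 : 0 ≤ z + w :=
    add_nonneg (show (0 : H →L[ℂ] H) ≤ z from hz) (show (0 : H →L[ℂ] H) ≤ w from hw)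
  have h : e.toExt (z + w) = φ (S + T) := by rw [e.toExt_add hz hw, hφ.map_add S T hS hT, hzS, hwT]
  exact ⟨⟨z + w, h0, h⟩, by rw [value_eq h0 h, value_eq hz hzS, value_eq hw hwT]⟩

theorem IsZTrace.mono (hφ : IsZTrace hZN e φ) {S T : N} (hS : 0 ≤ S) (hST : S ≤ T) :
    φ S ≤ φ T := by
  have h0 : 0 ≤ T - S := sub_nonneg.2 (show (S : H →L[ℂ] H) ≤ T from hST)
  have h := hφ.map_add S (T - S) hS h0
  rw [add_sub_cancel] at h
  rw [h, ← AEEqFun.coeFn_le]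
  filter_upwards [AEEqFun.coeFn_add (φ S) (φ (T - S))] with x hx
  rw [hx]
  exact le_self_add

theorem IsZTrace.finiteAt_of_le (hφ : IsZTrace hZN e φ) {S T : N} (hS : 0 ≤ S) (hST : S ≤ T)
    (hT : FiniteAt e φ T) : FiniteAt e φ S := by
  obtain ⟨z, -, hz⟩ := hT
  exact e.exists_toExt_eq_of_le (z := z) (hz ▸ hφ.mono hS hST)

theorem IsZTrace.finiteAt_zero (hφ : IsZTrace hZN e φ) :
    FiniteAt e φ (0 : N) ∧ value e φ (0 : N) = 0 := by
  have h : e.toExt 0 = φ 0 := by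
    -- Additivity alone would allow `φ 0 = ∞`; homogeneity at `z = 0` excludes it, since `0 * ∞ =
    -- 0`.
    have h1 := hφ.map_mul 0 0 le_rfl le_rfl
    rw [mul_zero] at h1
    rw [h1]
    refine AEEqFun.ext ?_
    have h2 : (e.toLinearEquiv 0 : X → ℂ) =ᵐ[ν] 0 := by
      rw [map_zero]
      exact Lp.coeFn_zero _ _ _
    filter_upwards [e.coeFn_toExt 0, h2, AEEqFun.coeFn_comp₂Measurable
      (fun a b : ℝ≥0∞ => a * b) (measurable_fst.mul measurable_snd) (e.toExt 0) (φ 0)]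
      with x h1 h2 h3
    rw [ExtPos.mul, h3, h1, h2]
    simp
  exact ⟨⟨0, le_rfl, h⟩, value_eq le_rfl h⟩

/-! ### Invariance of the trace under Murray–von Neumann equivalence -/

instance instIsOrderedAddMonoid (N : VonNeumannAlgebra H) : IsOrderedAddMonoid N where
  add_le_add_left a b h c :=
    add_le_add_left (show (a : H →L[ℂ] H) ≤ b from h) (c : H →L[ℂ] H)

/-- The value `z` of the linear extension of `φ` at the self-adjoint element `A + A*`. -/
def HasRealTrace (e : LInftyIso Z ν) (φ : N → ExtPos ν) (A : N) (z : Z) : Prop :=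
  ∃ P Q : N, 0 ≤ P ∧ 0 ≤ Q ∧ FiniteAt e φ P ∧ FiniteAt e φ Q ∧ A + star A = P - Q ∧
    z = value e φ P - value e φ Q

namespace IsZTrace

theorem hasRealTrace_unique (hφ : IsZTrace hZN e φ) {A : N} {z w : Z}
    (hz : HasRealTrace e φ A z) (hw : HasRealTrace e φ A w) : z = w := by
  obtain ⟨P, Q, hP, hQ, hPf, hQf, h, rfl⟩ := hz
  obtain ⟨P', Q', hP', hQ', hPf', hQf', h', rfl⟩ := hw
  have h1 : P + Q' = P' + Q := sub_eq_sub_iff_add_eq_add.1 (h.symm.trans h')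
  have h2 := (hφ.finiteAt_add hP hQ' hPf hQf').2
  rw [h1, (hφ.finiteAt_add hP' hQ hPf' hQf).2] at h2
  exact sub_eq_sub_iff_add_eq_add.2 h2.symm

theorem hasRealTrace_add (hφ : IsZTrace hZN e φ) {A B : N} {z w : Z}
    (hz : HasRealTrace e φ A z) (hw : HasRealTrace e φ B w) :
    HasRealTrace e φ (A + B) (z + w) := by
  obtain ⟨P, Q, hP, hQ, hPf, hQf, h, rfl⟩ := hz
  obtain ⟨P', Q', hP', hQ', hPf', hQf', h', rfl⟩ := hw
  have h1 := hφ.finiteAt_add hP hP' hPf hPf'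
  have h2 := hφ.finiteAt_add hQ hQ' hQf hQf'
  refine ⟨P + P', Q + Q', add_nonneg hP hP', add_nonneg hQ hQ', h1.1, h2.1, ?_, ?_⟩
  · rw [star_add, add_add_add_comm, h, h']
    abel
  · rw [h1.2, h2.2]
    abel

theorem conj_nonneg {S : N} (hS : 0 ≤ S) (A : N) : 0 ≤ A * S * star A :=
  star_right_conjugate_nonneg (show (0 : H →L[ℂ] H) ≤ S from hS) (A : H →L[ℂ] H)

theorem finiteAt_unitary (hφ : IsZTrace hZN e φ) {S U : N} (hS : 0 ≤ S) (hSf : FiniteAt e φ S)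
    (hU : U ∈ unitary N) :
    FiniteAt e φ (U * S * star U) ∧ value e φ (U * S * star U) = value e φ S := by
  have h := hφ.map_unitary S U hS hU
  exact ⟨by rwa [FiniteAt, h], (value_congr hSf h.symm).symm⟩

theorem hasRealTrace_unitary (hφ : IsZTrace hZN e φ) {A U : N} {z : Z}
    (hz : HasRealTrace e φ A z) (hU : U ∈ unitary N) :
    HasRealTrace e φ (U * A * star U) z := by
  obtain ⟨P, Q, hP, hQ, hPf, hQf, h, rfl⟩ := hz
  have h1 := hφ.finiteAt_unitary hP hPf hU
  have h2 := hφ.finiteAt_unitary hQ hQf hU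
  refine ⟨_, _, conj_nonneg hP U, conj_nonneg hQ U, h1.1, h2.1, ?_, by rw [h1.2, h2.2]⟩
  rw [star_mul, star_mul, star_star, ← mul_assoc, ← add_mul, ← mul_add, h, mul_sub, sub_mul]

theorem finiteAt_nsmul (hφ : IsZTrace hZN e φ) {S : N} (hS : 0 ≤ S)
    (hSf : FiniteAt e φ S) (n : ℕ) : FiniteAt e φ (n • S) := by
  induction n with
  | zero => simpa using hφ.finiteAt_zero.1
  | succ n ih =>
    rw [succ_nsmul]
    exact (hφ.finiteAt_add (nsmul_nonneg hS n) hS ih hSf).1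

/-- Invariance settles unitary `A`; since unitaries span `N`, domination by finite elements does the
rest. -/
theorem finiteAt_conj (hφ : IsZTrace hZN e φ) {S : N} (hS : 0 ≤ S) (hSf : FiniteAt e φ S) (A : N) :
    FiniteAt e φ (A * S * star A) := by
  have hA : A ∈ Submodule.span ℂ (unitary N : Set N) := by
    rw [span_unitary_eq_top]; trivial
  induction hA using Submodule.span_induction with
  | mem U hU => exact (hφ.finiteAt_unitary hS hSf hU).1
  | zero => simpa using hφ.finiteAt_zero.1
  | add A B _ _ hA hB =>
    have h1 := conj_nonneg hS A
    have h2 := conj_nonneg hS B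
    have h := (hφ.finiteAt_add (add_nonneg h1 h1) (add_nonneg h2 h2)
      (hφ.finiteAt_add h1 h1 hA hA).1 (hφ.finiteAt_add h2 h2 hB hB).1).1
    refine hφ.finiteAt_of_le (conj_nonneg hS _) ?_ h
    rw [← sub_nonneg]
    -- Parallelogram identity: `2ASA* + 2BSB* - (A+B)S(A+B)* = (A-B)S(A-B)*`.
    convert! conj_nonneg hS (A - B) using 1
    rw [star_add, star_sub]
    noncomm_ring
  | smul c A _ hA =>
    have h1 := conj_nonneg hS A
    obtain ⟨n, hn⟩ := exists_nat_ge (‖c‖ ^ 2)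
    refine hφ.finiteAt_of_le (conj_nonneg hS _) ?_ (hφ.finiteAt_nsmul h1 hA n)
    rw [← sub_nonneg]
    have h2 : 0 ≤ (Real.sqrt (n - ‖c‖ ^ 2) : ℂ) • A * S * star ((Real.sqrt (n - ‖c‖ ^ 2) : ℂ) • A) :=
      conj_nonneg hS _
    convert! h2 using 1
    simp only [star_smul, smul_mul_assoc, mul_smul_comm, smul_smul, ← Nat.cast_smul_eq_nsmul ℂ,
      ← sub_smul]
    congr 1
    rw [RCLike.star_def, Complex.conj_ofReal, ← Complex.ofReal_mul,
      Real.mul_self_sqrt (by linarith), ← Complex.normSq_eq_conj_mul_self, Complex.normSq_eq_norm_sq]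
    push_cast
    rfl

/-- Polarization: `ASB + (ASB)* = (A+B*)S(A+B*)* - (ASA* + B*SB)`. -/
theorem exists_hasRealTrace (hφ : IsZTrace hZN e φ) {S : N} (hS : 0 ≤ S) (hSf : FiniteAt e φ S)
    (A B : N) : ∃ z, HasRealTrace e φ (A * S * B) z := by
  have hsa : star S = S := Subtype.ext (show (0 : H →L[ℂ] H) ≤ S from hS).isSelfAdjoint
  have h1 := conj_nonneg hS A
  have h2 := conj_nonneg hS (star B)
  have h3 := hφ.finiteAt_conj hS hSf A
  have h4 := hφ.finiteAt_conj hS hSf (star B)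
  refine ⟨_, _, _, conj_nonneg hS (A + star B), add_nonneg h1 h2, hφ.finiteAt_conj hS hSf _,
    (hφ.finiteAt_add h1 h2 h3 h4).1, ?_, rfl⟩
  simp only [star_mul, star_add, star_star, hsa]
  noncomm_ring

/-- For unitary `A` the two products are conjugate by `A`; linearity over the span of unitaries
gives the general case. -/
theorem hasRealTrace_mul_comm (hφ : IsZTrace hZN e φ) {S : N} (hS : 0 ≤ S)
    (hSf : FiniteAt e φ S) (A B : N) {z : Z} (hz : HasRealTrace e φ (A * (S * B)) z) :
    HasRealTrace e φ (S * B * A) z := by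
  have hA : A ∈ Submodule.span ℂ (unitary N : Set N) := by
    rw [span_unitary_eq_top]; trivial
  induction hA using Submodule.span_induction generalizing z B with
  | mem U hU =>
    have h := hφ.hasRealTrace_unitary hz (Unitary.star_mem hU)
    rwa [star_star, ← mul_assoc, Unitary.star_mul_self_of_mem hU, one_mul] at h
  | zero => simpa using hz
  | add A A' _ _ hA hA' =>
    obtain ⟨w, hw⟩ := hφ.exists_hasRealTrace hS hSf A B
    obtain ⟨w', hw'⟩ := hφ.exists_hasRealTrace hS hSf A' B
    rw [mul_assoc] at hw hw'
    have h := hφ.hasRealTrace_add hw hw'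
    rw [← add_mul] at h
    rw [hφ.hasRealTrace_unique hz h, mul_add]
    exact hφ.hasRealTrace_add (hA B hw) (hA' B hw')
  | smul c A _ hA =>
    -- The real trace is not complex-linear, so the scalar is absorbed into `B`, over which the
    -- induction is generalized.
    have h := hA (c • B) (z := z)
    simp only [mul_smul_comm, smul_mul_assoc] at h hz ⊢
    exact h hz

theorem hasRealTrace_of_nonneg (hφ : IsZTrace hZN e φ) {S : N} (hS : 0 ≤ S)
    (hSf : FiniteAt e φ S) : HasRealTrace e φ S (value e φ S + value e φ S) := by
  have h := hφ.finiteAt_add hS hS hSf hSf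
  have hsa : star S = S := Subtype.ext (show (0 : H →L[ℂ] H) ≤ S from hS).isSelfAdjoint
  refine ⟨S + S, 0, add_nonneg hS hS, le_rfl, h.1, hφ.finiteAt_zero.1, by rw [hsa, sub_zero], ?_⟩
  rw [hφ.finiteAt_zero.2, h.2, sub_zero]

/-- Equivalent projections have the same trace. -/
theorem finiteAt_mul_star (hφ : IsZTrace hZN e φ) {V : N} (hV : IsStarProjection (star V * V))
    (hf : FiniteAt e φ (star V * V)) (hVV : V * (star V * V) = V) :
    FiniteAt e φ (V * star V) ∧ value e φ (V * star V) = value e φ (star V * V) := by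
  have h0 := nonneg_of_isStarProjection hV
  have h1 := hφ.finiteAt_conj h0 hf V
  rw [hVV] at h1
  have h2 := hφ.hasRealTrace_of_nonneg (nonneg_mul_star_self V) h1
  have h3 : V * star V = V * (star V * V * star V) := by rw [← mul_assoc, hVV]
  rw [h3] at h2
  -- With `P = V*V`, moving the leading `V` of `V(PV*)` to the end gives `PV*V = P`.
  have h4 := hφ.hasRealTrace_mul_comm h0 hf V (star V) h2
  rw [mul_assoc (star V * V), hV.isIdempotentElem, ← h3] at h4
  have h5 := hφ.hasRealTrace_unique h4 (hφ.hasRealTrace_of_nonneg h0 hf)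
  refine ⟨h1, ?_⟩
  rw [← two_smul ℂ, ← two_smul ℂ] at h5
  exact smul_right_injective Z (two_ne_zero' ℂ) h5

theorem finiteAt_rangeProj_star (hφ : IsZTrace hZN e φ) {T : N}
    (h : FiniteAt e φ (rangeProj T)) :
    FiniteAt e φ (rangeProj (star T)) ∧
      value e φ (rangeProj (star T)) = value e φ (rangeProj T) := by
  obtain ⟨V, h1, h2⟩ := exists_partialIsometry (star T)
  rw [star_star] at h1
  rw [← h1] at h ⊢
  rw [← h2]
  have hp : IsStarProjection (star V * V) := h1 ▸ isStarProjection_rangeProj T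
  refine hφ.finiteAt_mul_star hp h ?_
  have h3 : star (V - V * (star V * V)) * (V - V * (star V * V)) = 0 := by
    have h4 : star V * V * (star V * V) = star V * V := hp.isIdempotentElem
    have : star (V - V * (star V * V)) * (V - V * (star V * V)) =
        star V * V - star V * V * (star V * V) - star V * V * (star V * V) +
          star V * V * (star V * V) * (star V * V) := by
      simp only [star_sub, star_mul, star_star]
      noncomm_ring
    rw [this, h4, h4]
    abel
  have h5 : V - V * (star V * V) = 0 := by
    refine Subtype.ext ?_
    exact CStarRing.star_mul_self_eq_zero_iff _ |>.1 congr(($h3 : H →L[ℂ] H))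
  exact (sub_eq_zero.1 h5).symm

end IsZTrace

/-! ### Finite projections and operators of finite rank -/

theorem star_mul_eq_of_mul_eq {E B : N} (hE : IsStarProjection E) (h : E * B = B) :
    star B * E = star B := by
  simpa [hE.isSelfAdjoint.star_eq] using congr(star $h)

theorem mul_eq_of_one_sub_mul_eq_zero {E B : N} (h : (1 - E) * B = 0) : E * B = B := by
  rw [sub_mul, one_mul, sub_eq_zero] at h
  exact h.symm

theorem isStarProjection_sub {E P : N} (hE : IsStarProjection E) (hP : IsStarProjection P)
    (h : E * P = P) : IsStarProjection (E - P) :=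
  hP.sub_of_mul_eq_right hE h

namespace IsZTrace

theorem isFiniteProj_zero (hφ : IsZTrace hZN e φ) : IsFiniteProj e φ (0 : N) :=
  ⟨IsStarProjection.zero N, hφ.finiteAt_zero.1⟩

theorem isFiniteProj_of_mul_eq (hφ : IsZTrace hZN e φ) {E P : N} (hE : IsFiniteProj e φ E)
    (hP : IsStarProjection P) (h : E * P = P) : IsFiniteProj e φ P := by
  refine ⟨hP, hφ.finiteAt_of_le (nonneg_of_isStarProjection hP) ?_ hE.2⟩
  exact sub_nonneg.1 (nonneg_of_isStarProjection (isStarProjection_sub hE.1 hP h))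

theorem value_sub (hφ : IsZTrace hZN e φ) {E P : N} (hE : IsFiniteProj e φ E)
    (hP : IsStarProjection P) (h : E * P = P) :
    value e φ (E - P) = value e φ E - value e φ P := by
  have hs := isStarProjection_sub hE.1 hP h
  have h1 : E * (E - P) = E - P := by rw [mul_sub, hE.1.isIdempotentElem, h]
  have h2 := hφ.finiteAt_add (nonneg_of_isStarProjection hs) (nonneg_of_isStarProjection hP)
    (hφ.isFiniteProj_of_mul_eq hE hs h1).2 (hφ.isFiniteProj_of_mul_eq hE hP h).2
  rw [sub_add_cancel] at h2
  rw [h2.2, add_sub_cancel_right]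

theorem isFiniteProj_rangeProj_star (hφ : IsZTrace hZN e φ) {E B : N} (hE : IsFiniteProj e φ E)
    (h : E * B = B) : IsFiniteProj e φ (rangeProj (star B)) :=
  ⟨isStarProjection_rangeProj _, (hφ.finiteAt_rangeProj_star (hφ.isFiniteProj_of_mul_eq hE
    (isStarProjection_rangeProj B) (mul_rangeProj_of_mul_eq hE.1 h)).2).1⟩

theorem exists_isFiniteProj_mul_eq_right (hφ : IsZTrace hZN e φ) {E B : N}
    (hE : IsFiniteProj e φ E) (h : E * B = B) : ∃ F, IsFiniteProj e φ F ∧ B * F = B :=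
  ⟨_, hφ.isFiniteProj_rangeProj_star hE h, mul_rangeProj_star B⟩

/-- Take `G = E + R` with `R` the range projection of `(1 - E)F`. It is orthogonal to `E`, and
finite because it is equivalent to a subprojection of `F`. -/
theorem exists_isFiniteProj_sup (hφ : IsZTrace hZN e φ) {E F : N} (hE : IsFiniteProj e φ E)
    (hF : IsFiniteProj e φ F) : ∃ G, IsFiniteProj e φ G ∧ G * E = E ∧ G * F = F := by
  have h1 : F * (F * (1 - E)) = F * (1 - E) := by rw [← mul_assoc, hF.1.isIdempotentElem]
  have h2 := hφ.isFiniteProj_rangeProj_star hF h1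
  have h3 : star (F * (1 - E)) = (1 - E) * F := by
    rw [star_mul, hE.1.one_sub.isSelfAdjoint.star_eq, hF.1.isSelfAdjoint.star_eq]
  rw [h3] at h2
  set R := rangeProj ((1 - E) * F) with hR
  have h4 : (1 - E) * R = R := mul_rangeProj_of_mul_eq hE.1.one_sub
    (by rw [← mul_assoc, hE.1.one_sub.isIdempotentElem])
  have hER : E * R = 0 := by
    rw [sub_mul, one_mul, sub_eq_self] at h4
    exact h4
  have hRE : R * E = 0 := by
    simpa [hE.1.isSelfAdjoint.star_eq, h2.1.isSelfAdjoint.star_eq] using congr(star $hER)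
  have h5 : R * F = (1 - E) * F := by
    have := rangeProj_mul ((1 - E) * F)
    rw [← hR, ← mul_assoc, mul_sub, hRE, mul_one, sub_zero] at this
    exact this
  refine ⟨E + R, ⟨hE.1.add h2.1 hER, (hφ.finiteAt_add (nonneg_of_isStarProjection hE.1)
    (nonneg_of_isStarProjection h2.1) hE.2 h2.2).1⟩, ?_, ?_⟩
  · rw [add_mul, hRE, hE.1.isIdempotentElem, add_zero]
  · rw [add_mul, h5]
    noncomm_ring

end IsZTrace

/-- `B` has `φ`-finite range. -/
def IsFiniteRank (e : LInftyIso Z ν) (φ : N → ExtPos ν) (B : N) : Prop :=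
  ∃ E, IsFiniteProj e φ E ∧ E * B = B

theorem IsFiniteRank.mul_right {B : N} (hB : IsFiniteRank e φ B) (A : N) :
    IsFiniteRank e φ (B * A) := by
  obtain ⟨E, hE, h⟩ := hB
  exact ⟨E, hE, by rw [← mul_assoc, h]⟩

theorem IsFiniteRank.neg {B : N} (hB : IsFiniteRank e φ B) : IsFiniteRank e φ (-B) := by
  obtain ⟨E, hE, h⟩ := hB
  exact ⟨E, hE, by rw [mul_neg, h]⟩

theorem IsFiniteProj.isFiniteRank {E : N} (hE : IsFiniteProj e φ E) : IsFiniteRank e φ E :=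
  ⟨E, hE, hE.1.isIdempotentElem⟩

namespace IsZTrace

/-- Left and right supports are equivalent, hence finite together; this makes finite rank a
two-sided notion. -/
theorem isFiniteRank_star (hφ : IsZTrace hZN e φ) {B : N} (hB : IsFiniteRank e φ B) :
    IsFiniteRank e φ (star B) := by
  obtain ⟨E, hE, h⟩ := hB
  exact ⟨_, hφ.isFiniteProj_rangeProj_star hE h, rangeProj_mul _⟩

theorem isFiniteRank_mul_left (hφ : IsZTrace hZN e φ) {B : N} (hB : IsFiniteRank e φ B) (A : N) :
    IsFiniteRank e φ (A * B) := by
  simpa using hφ.isFiniteRank_star ((hφ.isFiniteRank_star hB).mul_right (star A))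

theorem isFiniteRank_add (hφ : IsZTrace hZN e φ) {A B : N} (hA : IsFiniteRank e φ A)
    (hB : IsFiniteRank e φ B) : IsFiniteRank e φ (A + B) := by
  obtain ⟨E, hE, hEA⟩ := hA
  obtain ⟨F, hF, hFB⟩ := hB
  obtain ⟨G, hG, hGE, hGF⟩ := hφ.exists_isFiniteProj_sup hE hF
  refine ⟨G, hG, ?_⟩
  rw [mul_add, ← hEA, ← mul_assoc, hGE, ← hFB, ← mul_assoc, hGF]

theorem isFiniteRank_zero (hφ : IsZTrace hZN e φ) : IsFiniteRank e φ (0 : N) :=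
  ⟨0, hφ.isFiniteProj_zero, mul_zero _⟩

end IsZTrace

/-! ### Fredholm operators -/

/-- Range inclusion becomes factorization within `N`, so the remaining arguments are algebraic. -/
theorem isFredholm_iff {T : N} : IsFredholm e φ T ↔ IsFiniteProj e φ (kerProj T) ∧
    ∃ E S : N, IsFiniteProj e φ E ∧ T * S = 1 - E := by
  refine and_congr_right fun _ => ⟨?_, ?_⟩
  · rintro ⟨E, hE, h⟩
    obtain ⟨S, hS⟩ := exists_mul_eq_of_range_subset h
    exact ⟨E, S, hE, hS⟩
  · rintro ⟨E, S, hE, hS⟩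
    refine ⟨E, hE, ?_⟩
    rintro _ ⟨x, rfl⟩
    exact ⟨(S : H →L[ℂ] H) x, congr(($hS : H →L[ℂ] H) x)⟩

theorem mul_mul_one_sub_eq {T S E G : N} (hG : IsStarProjection G) (hE : IsStarProjection E)
    (h : T * S = 1 - E) (hGE : G * E = E) : T * (S * (1 - G)) = 1 - G := by
  have h1 : E * G = E := by simpa [hE.isSelfAdjoint.star_eq] using star_mul_eq_of_mul_eq hG hGE
  rw [← mul_assoc, h, sub_mul, mul_sub E, h1, mul_one, one_mul, sub_self, sub_zero]

/-- `A(1 - SA) = EA`. Once `ker ((1 - E)A)` is known to be finite, this makes the right parametrix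
`S` a left one. -/
theorem one_sub_mul_mul_one_sub_eq_zero {A S E : N} (hE : IsStarProjection E)
    (h : A * S = 1 - E) : (1 - E) * A * (1 - S * A) = 0 := by
  have h1 : A * (1 - S * A) = E * A := by
    rw [mul_sub, ← mul_assoc, h]
    noncomm_ring
  rw [mul_assoc, h1, ← mul_assoc, hE.one_sub_mul_self, zero_mul]

theorem mul_kerProj_star_of_mul_eq {A S E : N} (hE : IsStarProjection E) (h : A * S = 1 - E) :
    E * kerProj (star A) = kerProj (star A) := by
  refine mul_eq_of_one_sub_mul_eq_zero ?_
  have h1 : star S * star A = 1 - E := by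
    rw [← star_mul, h, hE.one_sub.isSelfAdjoint.star_eq]
  rw [← h1, mul_assoc, mul_kerProj, mul_zero]

namespace IsZTrace

variable {A B S T E : N}

/-- Cutting a Fredholm operator down to a closed range that its range contains. -/
theorem kerProj_one_sub_mul (hφ : IsZTrace hZN e φ) (hA : IsFiniteProj e φ (kerProj A))
    (hE : IsFiniteProj e φ E) (h : A * S = 1 - E) :
    IsFiniteProj e φ (kerProj ((1 - E) * A)) ∧ kerProj (star ((1 - E) * A)) = E ∧
      index e φ ((1 - E) * A) = index e φ A := by
  have hE1 := hE.1.one_sub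
  have hstar : kerProj (star ((1 - E) * A)) = E := by
    have h1 : star S * star A = 1 - E := by
      rw [← star_mul, h, hE1.isSelfAdjoint.star_eq]
    rw [star_mul, hE1.isSelfAdjoint.star_eq]
    refine eq_kerProj hE.1 (by rw [mul_assoc, hE.1.one_sub_mul_self, mul_zero]) fun Y hY => ?_
    refine mul_eq_of_one_sub_mul_eq_zero ?_
    rw [← hE1.isIdempotentElem.eq]
    nth_rw 1 [← h1]
    rw [mul_assoc, mul_assoc, ← mul_assoc (star A), hY, mul_zero]
  have hkA := star_kerProj A
  set k := kerProj A
  set K := kerProj ((1 - E) * A) with hK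
  have hKs : star K = K := star_kerProj _
  have hAk : A * k = 0 := mul_kerProj A
  have hkA' : k * star A = 0 := by simpa using kerProj_star_mul (star A)
  have hKk : K * k = k := kerProj_mul_of_mul_eq_zero (by rw [mul_assoc, hAk, mul_zero])
  have hkK : k * K = k := by simpa [hKs, hkA] using congr(star $hKk)
  have hEAK : E * (A * K) = A * K := mul_eq_of_one_sub_mul_eq_zero (by
    rw [← mul_assoc, hK, mul_kerProj])
  have hEn := mul_kerProj_star_of_mul_eq hE.1 h
  have hnE : kerProj (star A) * E = kerProj (star A) := by
    simpa [star_kerProj] using star_mul_eq_of_mul_eq hE.1 hEn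
  -- The supports of `AK` are `E - kerProj (star A)` and `K - k`; equating their traces gives `φ(K)
  -- = φ(k) + φ(E) - φ(kerProj (star A))`.
  have hrange : rangeProj (A * K) = E - kerProj (star A) := by
    refine eq_rangeProj (isStarProjection_sub hE.1 (isStarProjection_kerProj _) hEn) ?_ ?_
    · rw [sub_mul, hEAK, ← mul_assoc, kerProj_star_mul, zero_mul, sub_zero]
    · intro Y hY
      have h1 : K * (1 - S * A) = 1 - S * A :=
        kerProj_mul_of_mul_eq_zero (one_sub_mul_mul_one_sub_eq_zero hE.1 h)
      have h2 : A * K * (1 - S * A) = E * A := by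
        rw [mul_assoc, h1, mul_sub, ← mul_assoc, h]
        noncomm_ring
      have h3 : star A * (E * Y) = 0 := by
        have := congr(star $h2)
        rw [star_mul, star_mul E, hE.1.isSelfAdjoint.star_eq] at this
        rw [← mul_assoc, ← this, mul_assoc, hY, mul_zero]
      have h4 := kerProj_mul_of_mul_eq_zero h3
      rw [← mul_assoc, hnE] at h4
      rw [sub_mul, h4, sub_self]
  have hcorange : rangeProj (star (A * K)) = K - k := by
    refine eq_rangeProj (isStarProjection_sub (isStarProjection_kerProj _)
      (isStarProjection_kerProj _) hKk) ?_ ?_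
    · rw [star_mul, hKs, ← mul_assoc, sub_mul, kerProj_mul_self, hkK, sub_mul, hkA', sub_zero]
    · intro Y hY
      rw [star_star, mul_assoc] at hY
      have := kerProj_mul_of_mul_eq_zero hY
      rw [← mul_assoc, hkK] at this
      rw [sub_mul, ← this, sub_self]
  have hf := hφ.isFiniteProj_rangeProj_star hE hEAK
  have hn := hφ.isFiniteProj_of_mul_eq hE (isStarProjection_kerProj _) hEn
  have hEn' : E * (E - kerProj (star A)) = E - kerProj (star A) := by
    rw [mul_sub, hE.1.isIdempotentElem, hEn]
  have hval := (hφ.finiteAt_rangeProj_star (T := A * K) (by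
    rw [hrange]
    exact (hφ.isFiniteProj_of_mul_eq hE
      (isStarProjection_sub hE.1 (isStarProjection_kerProj _) hEn) hEn').2)).2
  rw [hcorange, hrange, hφ.value_sub hE (isStarProjection_kerProj _) hEn] at hval
  rw [hcorange] at hf
  have hadd := hφ.finiteAt_add (nonneg_of_isStarProjection hf.1)
    (nonneg_of_isStarProjection hA.1) hf.2 hA.2
  rw [sub_add_cancel] at hadd
  refine ⟨⟨isStarProjection_kerProj _, hadd.1⟩, hstar, ?_⟩
  rw [index, index, hstar, hadd.2, hval]
  abel

theorem isFredholm_add (hφ : IsZTrace hZN e φ) (hA : IsFredholm e φ A)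
    (hB : IsFiniteRank e φ B) : IsFredholm e φ (A + B) := by
  obtain ⟨hk, E, S, hE, hS⟩ := isFredholm_iff.1 hA
  obtain ⟨F, hF, hFB⟩ := hB
  refine isFredholm_iff.2 ⟨?_, ?_⟩
  · obtain ⟨G, hG, hGE, hGF⟩ := hφ.exists_isFiniteProj_sup hE hF
    have h1 := (hφ.kerProj_one_sub_mul hk hG (mul_mul_one_sub_eq hG.1 hE.1 hS hGE)).1
    refine hφ.isFiniteProj_of_mul_eq h1 (isStarProjection_kerProj _)
      (kerProj_mul_of_mul_eq_zero ?_)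
    -- Since `G` absorbs `B`, the kernel of `A + B` lies in that of `(1 - G)A`, which is finite.
    have h2 : (1 - G) * B = 0 := by
      rw [← hFB, ← mul_assoc, sub_mul, hGF, one_mul, sub_self, zero_mul]
    have h3 : (1 - G) * A = (1 - G) * (A + B) := by rw [mul_add, h2, add_zero]
    rw [h3, mul_assoc, mul_kerProj, mul_zero]
  · obtain ⟨E', hE', hBE'⟩ := hφ.exists_isFiniteProj_mul_eq_right hF hFB
    have h1 : IsFiniteRank e φ (star S * E') := hφ.isFiniteRank_mul_left hE'.isFiniteRank _
    obtain ⟨F', hF', hF'S⟩ := h1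
    -- This `G` also dominates the range of `S*E'`, so `B * S * (1 - G) = 0` and `S(1 - G)` serves
    -- `A + B` as well as `A`.
    obtain ⟨G, hG, hGE, hGF⟩ := hφ.exists_isFiniteProj_sup hE hF'
    refine ⟨G, S * (1 - G), hG, ?_⟩
    have h2 : G * (star S * E') = star S * E' := by rw [← hF'S, ← mul_assoc, hGF]
    have h3 : E' * S * G = E' * S := by
      simpa [hE'.1.isSelfAdjoint.star_eq] using star_mul_eq_of_mul_eq hG.1 h2
    rw [add_mul, mul_mul_one_sub_eq hG.1 hE.1 hS hGE, ← hBE', mul_assoc, ← mul_assoc E', mul_sub,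
      h3, mul_one, sub_self, mul_zero, add_zero]

/-- One finite `G` dominates all projections involved; then `(1 - G)A = (1 - G)(A + B)`, and cutting
preserves both indices. -/
theorem index_add (hφ : IsZTrace hZN e φ) (hA : IsFredholm e φ A)
    (hB : IsFiniteRank e φ B) : index e φ (A + B) = index e φ A := by
  obtain ⟨hk', E', S', hE', hS'⟩ := isFredholm_iff.1 (hφ.isFredholm_add hA hB)
  obtain ⟨hk, E, S, hE, hS⟩ := isFredholm_iff.1 hA
  obtain ⟨F, hF, hFB⟩ := hB
  obtain ⟨G₀, hG₀, hGE₀, hGE₀'⟩ := hφ.exists_isFiniteProj_sup hE hE'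
  obtain ⟨G, hG, hGG₀, hGF⟩ := hφ.exists_isFiniteProj_sup hG₀ hF
  have hGE : G * E = E := by rw [← hGE₀, ← mul_assoc, hGG₀]
  have hGE' : G * E' = E' := by rw [← hGE₀', ← mul_assoc, hGG₀]
  have h1 := (hφ.kerProj_one_sub_mul hk hG (mul_mul_one_sub_eq hG.1 hE.1 hS hGE)).2.2
  have h2 := (hφ.kerProj_one_sub_mul hk' hG (mul_mul_one_sub_eq hG.1 hE'.1 hS' hGE')).2.2
  have h3 : (1 - G) * B = 0 := by
    rw [← hFB, ← mul_assoc, sub_mul, hGF, one_mul, sub_self, zero_mul]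
  rw [← h2, ← h1, mul_add, h3, add_zero]

theorem kerProj_of_isUnit (hA : IsUnit A) : kerProj A = 0 := by
  obtain ⟨u, rfl⟩ := hA
  have := congr((↑u⁻¹ : N) * $(mul_kerProj (u : N)))
  rwa [← mul_assoc, Units.inv_mul, one_mul, mul_zero] at this

theorem isFredholm_of_isUnit (hφ : IsZTrace hZN e φ) (hA : IsUnit A) :
    IsFredholm e φ A ∧ index e φ A = 0 := by
  have h1 := kerProj_of_isUnit hA
  have h2 := kerProj_of_isUnit hA.star
  refine ⟨isFredholm_iff.2 ⟨h1 ▸ hφ.isFiniteProj_zero, 0, ?_⟩, by rw [index, h1, h2, sub_self]⟩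
  obtain ⟨u, rfl⟩ := hA
  exact ⟨(↑u⁻¹ : N), hφ.isFiniteProj_zero, by rw [Units.mul_inv, sub_zero]⟩

/-- A Fredholm operator has a right parametrix, which is also a left parametrix. -/
theorem exists_parametrix (hφ : IsZTrace hZN e φ) (hT : IsFredholm e φ T) :
    ∃ E S : N, IsFiniteProj e φ E ∧ T * S = 1 - E ∧ IsFiniteRank e φ (1 - S * T) := by
  obtain ⟨hk, E, S, hE, hS⟩ := isFredholm_iff.1 hT
  refine ⟨E, S, hE, hS, _, (hφ.kerProj_one_sub_mul hk hE hS).1,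
    kerProj_mul_of_mul_eq_zero (one_sub_mul_mul_one_sub_eq_zero hE.1 hS)⟩

theorem isFredholm_star (hφ : IsZTrace hZN e φ) (hT : IsFredholm e φ T) :
    IsFredholm e φ (star T) := by
  obtain ⟨E, S, hE, hS, hB⟩ := hφ.exists_parametrix hT
  refine isFredholm_iff.2 ⟨hφ.isFiniteProj_of_mul_eq hE (isStarProjection_kerProj _)
    (mul_kerProj_star_of_mul_eq hE.1 hS), ?_⟩
  -- `T*S* = 1 - (1 - ST)*` is a finite-rank perturbation of the identity, so `T*` has a right
  -- parametrix.
  have h1 := hφ.isFredholm_add (hφ.isFredholm_of_isUnit isUnit_one).1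
    (hφ.isFiniteRank_star hB).neg
  obtain ⟨-, F, R, hF, hR⟩ := isFredholm_iff.1 h1
  refine ⟨F, star S * R, hF, ?_⟩
  rw [← hR, ← mul_assoc, ← star_mul, star_sub, star_one]
  noncomm_ring

theorem index_star : index e φ (star T) = -index e φ T := by
  rw [index, index, star_star, neg_sub]

/-- The index of a product, when the ranges and kernels of the factors fit together. -/
theorem index_mul_of_mul_eq (hφ : IsZTrace hZN e φ) (hS : IsFiniteProj e φ (kerProj S))
    (hT : IsFiniteProj e φ (kerProj T)) (hE : IsStarProjection E) {R : N} (hR : T * R = 1 - E)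
    (hET : E * T = 0) (hSE : S * E = 0) : index e φ (S * T) = index e φ S + index e φ T := by
  have hES : E * star S = 0 := by simpa [hE.isSelfAdjoint.star_eq] using congr(star $hSE)
  have hRT : star R * star T = 1 - E := by
    rw [← star_mul, hR, hE.one_sub.isSelfAdjoint.star_eq]
  have hkST : kerProj (star (S * T)) = kerProj (star S) := by
    refine eq_kerProj (isStarProjection_kerProj _)
      (by rw [star_mul, mul_assoc, mul_kerProj, mul_zero]) fun Y hY => ?_
    refine kerProj_mul_of_mul_eq_zero ?_
    rw [star_mul, mul_assoc] at hY
    have h1 := congr(star R * $hY)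
    rw [← mul_assoc, hRT, mul_zero, sub_mul, ← mul_assoc E, hES, zero_mul, one_mul, sub_zero] at h1
    exact h1
  have hkT : kerProj (star T) = E := by
    refine eq_kerProj hE (by simpa [hE.isSelfAdjoint.star_eq] using congr(star $hET))
      fun Y hY => mul_eq_of_one_sub_mul_eq_zero ?_
    rw [← hRT, mul_assoc, hY, mul_zero]
  have hEs : kerProj S * E = E := kerProj_mul_of_mul_eq_zero hSE
  have hsE : E * kerProj S = E := by
    simpa [hE.isSelfAdjoint.star_eq, star_kerProj] using congr(star $hEs)
  set t := kerProj T
  set n := kerProj (S * T) with hn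
  have hts : star t = t := star_kerProj _
  have hns : star n = n := star_kerProj _
  have hnt : n * t = t := kerProj_mul_of_mul_eq_zero (by rw [mul_assoc, mul_kerProj, mul_zero])
  have htn : t * n = t := by simpa [hts, hns] using congr(star $hnt)
  have htT : t * star T = 0 := by simpa using kerProj_star_mul (star T)
  have hQ : IsStarProjection (kerProj S - E) :=
    isStarProjection_sub (isStarProjection_kerProj _) hE hEs
  -- `T` carries `n - t` to an equivalent projection `kerProj S - E`, so `φ(n) = φ(t) + φ(kerProj S)
  -- - φ(E)`, where `E` is the cokernel projection of `T`.
  have hrange : rangeProj (T * n) = kerProj S - E := by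
    refine eq_rangeProj hQ ?_ ?_
    · rw [sub_mul, ← mul_assoc E, hET, zero_mul, sub_zero]
      exact kerProj_mul_of_mul_eq_zero (by rw [← mul_assoc, hn, mul_kerProj])
    · intro Y hY
      have h1 : T * (R * (kerProj S - E)) = kerProj S - E := by
        rw [← mul_assoc, hR, sub_mul, mul_sub E, hsE, hE.isIdempotentElem, sub_self, sub_zero,
          one_mul]
      have h2 : n * (R * (kerProj S - E)) = R * (kerProj S - E) :=
        kerProj_mul_of_mul_eq_zero (by rw [mul_assoc, h1, mul_sub, mul_kerProj, hSE, sub_zero])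
      have h3 : T * n * (R * (kerProj S - E)) = kerProj S - E := by rw [mul_assoc, h2, h1]
      have h4 := congr(star $h3)
      rw [star_mul, hQ.isSelfAdjoint.star_eq] at h4
      rw [← h4, mul_assoc, hY, mul_zero]
  have hcorange : rangeProj (star (T * n)) = n - t := by
    refine eq_rangeProj (isStarProjection_sub (isStarProjection_kerProj _)
      (isStarProjection_kerProj _) hnt) ?_ ?_
    · rw [star_mul, hns, ← mul_assoc, sub_mul, kerProj_mul_self, htn, sub_mul, htT, sub_zero]
    · intro Y hY
      rw [star_star, mul_assoc] at hY
      have := kerProj_mul_of_mul_eq_zero hY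
      rw [← mul_assoc, htn] at this
      rw [sub_mul, ← this, sub_self]
  have hQf : IsFiniteProj e φ (kerProj S - E) := hφ.isFiniteProj_of_mul_eq hS hQ (by
    rw [mul_sub, kerProj_mul_self, hEs])
  have hval := hφ.finiteAt_rangeProj_star (T := T * n) (hrange ▸ hQf.2)
  rw [hcorange, hrange, hφ.value_sub hS hE hEs] at hval
  have hadd := hφ.finiteAt_add (nonneg_of_isStarProjection (isStarProjection_sub
    (isStarProjection_kerProj _) (isStarProjection_kerProj _) hnt))
    (nonneg_of_isStarProjection hT.1) hval.1 hT.2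
  rw [sub_add_cancel] at hadd
  rw [index, index, index, hkST, hkT, hadd.2, hval.2]
  abel

/-- Replacing `S` by `S(1 - E)` and `T` by `(1 - E)T` alters both factors and their product only by
finite rank, and makes the factors fit. -/
theorem index_mul (hφ : IsZTrace hZN e φ) (hS : IsFredholm e φ S) (hT : IsFredholm e φ T)
    (hST : IsFredholm e φ (S * T)) : index e φ (S * T) = index e φ S + index e φ T := by
  obtain ⟨-, E, R, hE, hR⟩ := isFredholm_iff.1 hT
  have hSE : IsFiniteRank e φ (-(S * E)) := (hφ.isFiniteRank_mul_left hE.isFiniteRank S).neg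
  have hET : IsFiniteRank e φ (-(E * T)) := (hE.isFiniteRank.mul_right T).neg
  have hSET : IsFiniteRank e φ (-(S * E * T)) := by simpa using hSE.mul_right T
  rw [← hφ.index_add hST hSET, ← hφ.index_add hS hSE, ← hφ.index_add hT hET]
  have hSf := (hφ.isFredholm_add hS hSE).1
  have hTf := (hφ.isFredholm_add hT hET).1
  have h1 : S + -(S * E) = S * (1 - E) := by noncomm_ring
  have h2 : T + -(E * T) = (1 - E) * T := by noncomm_ring
  have h3 : S * T + -(S * E * T) = S * (1 - E) * ((1 - E) * T) := by
    rw [← mul_assoc, mul_assoc S (1 - E), hE.1.one_sub.isIdempotentElem]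
    noncomm_ring
  rw [h1] at hSf ⊢
  rw [h2] at hTf ⊢
  rw [h3]
  refine hφ.index_mul_of_mul_eq hSf hTf hE.1 (R := R * (1 - E)) ?_ ?_ ?_
  · rw [mul_assoc, ← mul_assoc T, hR, hE.1.one_sub.isIdempotentElem,
      hE.1.one_sub.isIdempotentElem]
  · rw [← mul_assoc, hE.1.mul_one_sub_self, zero_mul]
  · rw [mul_assoc, hE.1.one_sub_mul_self, mul_zero]

/-! ### The ideal of compact operators -/

theorem mem_compactIdeal_of_isFiniteRank (hB : IsFiniteRank e φ B) : B ∈ compactIdeal e φ := by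
  obtain ⟨E, hE, h⟩ := hB
  rw [← h]
  refine TwoSidedIdeal.mul_mem_right _ _ _ ?_
  rw [compactIdeal, TwoSidedIdeal.mem_sInf]
  exact fun I hI => hI.2 E hE

/-- The norm closure of the operators of finite rank. -/
def closureFiniteRank (hφ : IsZTrace hZN e φ) : TwoSidedIdeal N :=
  TwoSidedIdeal.mk' (closure {B | IsFiniteRank e φ B})
    (subset_closure hφ.isFiniteRank_zero)
    (fun hx hy => map_mem_closure₂ continuous_add hx hy fun _ ha _ hb => hφ.isFiniteRank_add ha hb)
    (fun hx => map_mem_closure continuous_neg hx fun _ ha => ha.neg)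
    (fun {x _} hy => map_mem_closure (continuous_const_mul x) hy
      fun _ ha => hφ.isFiniteRank_mul_left ha x)
    (fun {_ y} hx => map_mem_closure (f := (· * y)) (continuous_mul_const y) hx
      fun _ ha => IsFiniteRank.mul_right ha y)

theorem mem_closure_of_mem_compactIdeal (hφ : IsZTrace hZN e φ) (hT : T ∈ compactIdeal e φ) :
    T ∈ closure {B : N | IsFiniteRank e φ B} := by
  rw [compactIdeal, TwoSidedIdeal.mem_sInf] at hT
  have hcoe : (hφ.closureFiniteRank : Set N) = closure {B : N | IsFiniteRank e φ B} :=
    TwoSidedIdeal.coe_mk' ..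
  have h := hT (I := hφ.closureFiniteRank) ⟨hcoe ▸ isClosed_closure, fun E hE => by
    rw [← SetLike.mem_coe, hcoe]
    exact subset_closure hE.isFiniteRank⟩
  rwa [← SetLike.mem_coe, hcoe] at h

/-- The Fredholm alternative. -/
theorem isFredholm_one_sub (hφ : IsZTrace hZN e φ) (hT : T ∈ compactIdeal e φ) :
    IsFredholm e φ (1 - T) ∧ index e φ (1 - T) = 0 := by
  -- Distance below `1` makes `1 - (T - B)` invertible by the Neumann series.
  obtain ⟨B, hB, hTB⟩ := Metric.mem_closure_iff.1 (hφ.mem_closure_of_mem_compactIdeal hT) 1 one_pos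
  rw [dist_eq_norm] at hTB
  have hu := hφ.isFredholm_of_isUnit (isUnit_one_sub_of_norm_lt_one hTB)
  have hB' : IsFiniteRank e φ (-B) := IsFiniteRank.neg hB
  have h : 1 - T = 1 - (T - B) + -B := by abel
  rw [h]
  exact ⟨hφ.isFredholm_add hu.1 hB', (hφ.index_add hu.1 hB').trans hu.2⟩

theorem mk'_eq_mk'_iff {I : TwoSidedIdeal N} : I.ringCon.mk' A = I.ringCon.mk' B ↔ A - B ∈ I :=
  (RingCon.eq _).trans (I.rel_iff A B)

/-- Atkinson's theorem. -/
theorem isFredholm_iff_isUnit (hφ : IsZTrace hZN e φ) (T : N) :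
    IsFredholm e φ T ↔ IsUnit ((compactIdeal e φ).ringCon.mk' T) := by
  constructor
  · intro hT
    obtain ⟨E, S, hE, hS, hB⟩ := hφ.exists_parametrix hT
    refine isUnit_iff_exists.2 ⟨(compactIdeal e φ).ringCon.mk' S, ?_, ?_⟩
    · rw [← _root_.map_mul, ← map_one (compactIdeal e φ).ringCon.mk', mk'_eq_mk'_iff, hS,
        sub_sub_cancel_left]
      exact neg_mem (mem_compactIdeal_of_isFiniteRank hE.isFiniteRank)
    · rw [← _root_.map_mul, ← map_one (compactIdeal e φ).ringCon.mk', eq_comm, mk'_eq_mk'_iff]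
      exact mem_compactIdeal_of_isFiniteRank hB
  · intro hT
    obtain ⟨s, h1, h2⟩ := isUnit_iff_exists.1 hT
    obtain ⟨S, rfl⟩ := RingCon.mk'_surjective _ s
    rw [← _root_.map_mul, ← map_one (compactIdeal e φ).ringCon.mk', eq_comm, mk'_eq_mk'_iff] at h1 h2
    -- By the Fredholm alternative `TS` and `ST` are Fredholm: the first controls the range of `T`,
    -- the second its kernel.
    have h3 := (hφ.isFredholm_one_sub h1).1
    have h4 := (hφ.isFredholm_one_sub h2).1
    rw [sub_sub_cancel] at h3 h4
    obtain ⟨-, E, R, hE, hR⟩ := isFredholm_iff.1 h3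
    refine isFredholm_iff.2 ⟨hφ.isFiniteProj_of_mul_eq h4.1 (isStarProjection_kerProj _)
      (kerProj_mul_of_mul_eq_zero (by rw [mul_assoc, mul_kerProj, mul_zero])), E, S * R, hE, ?_⟩
    rw [← mul_assoc, hR]

theorem isFredholm_mul (hφ : IsZTrace hZN e φ) (hS : IsFredholm e φ S) (hT : IsFredholm e φ T) :
    IsFredholm e φ (S * T) := by
  rw [hφ.isFredholm_iff_isUnit] at hS hT ⊢
  rw [_root_.map_mul]
  exact hS.mul hT

end IsZTrace

end

end ZTrace

theorem theoremA1 {H : Type*} [NormedAddCommGroup H] [InnerProductSpace ℂ H] [CompleteSpace H]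
    {X : Type*} [MeasurableSpace X] {ν : MeasureTheory.Measure X}
    (N Z : VonNeumannAlgebra H) (hZN : Z ≤ N) (hZ : Z ≤ N.commutant)
    (e : ZTrace.LInftyIso Z ν) (φ : N → ZTrace.ExtPos ν)
    (hφ : ZTrace.IsZTrace hZN e φ) (hfaithful : ZTrace.IsFaithful φ)
    (hnormal : ZTrace.IsNormal φ) (hsemifinite : ZTrace.IsSemifinite e φ) :
    (∀ T ∈ ZTrace.compactIdeal e φ,
      ZTrace.IsFredholm e φ (1 - T) ∧ ZTrace.index e φ (1 - T) = 0) ∧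
    (∀ T : N, ZTrace.IsFredholm e φ T ↔ IsUnit ((ZTrace.compactIdeal e φ).ringCon.mk' T)) ∧
    (∀ S : N, ZTrace.IsFredholm e φ S →
      ZTrace.IsFredholm e φ (star S) ∧
        ZTrace.index e φ (star S) = -ZTrace.index e φ S) ∧
    (∀ S T : N, ZTrace.IsFredholm e φ S → ZTrace.IsFredholm e φ T →
      ZTrace.IsFredholm e φ (S * T) ∧
        ZTrace.index e φ (S * T) = ZTrace.index e φ S + ZTrace.index e φ T) :=
  ⟨fun _ hT => hφ.isFredholm_one_sub hT, hφ.isFredholm_iff_isUnit,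
    fun _ hS => ⟨hφ.isFredholm_star hS, ZTrace.IsZTrace.index_star⟩,
    fun _ _ hS hT => ⟨hφ.isFredholm_mul hS hT, hφ.index_mul hS hT (hφ.isFredholm_mul hS hT)⟩⟩
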